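/- Let $\mathbb{K}$ be an algebraically closed field of characteristic $0$. Let $S=\mathbb{K}[z_1,\ldots,z_r,x_1,\ldots,x_s]$ be the polynomial ring graded by $\deg(z_i)=d_i\ge 1$ and $\deg(x_j)=e_j\ge 1$, and let $A=\mathbb{K}[x_1,\ldots,x_s]\subset S$ be the graded subalgebra generated by the $x_j$. Let $P\in S$ and $Q_1,\ldots,Q_k\in A$ be homogeneous elements of positive degree. For a variable $z_i$, write $\mathrm{Disc}_{z_i}(P)=\mathrm{Res}_{z_i}\!\left(P,\frac{\partial P}{\partial z_i}\right)$ for the resultant of $P$ and $\frac{\partial P}{\partial z_i}$, viewed as univariate polynomials in $z_i$. Suppose that: 1. the ideal $(Q_1,\ldots,Q_k)$ of $A$ is radical and the quotient ring $A/(Q_1,\ldots,Q_k)$ is Cohen–Macaulay; 2. $P$ is square-free in $S$ (it has no multiple factors), and $P\notin (x_1,\ldots,x_s)S$; 3. for every $i\in\{1,\ldots,r\}$ such that the variable $z_i$ occurs in $P$, and for every minimal prime $\mathfrak{q}$ of $(Q_1,\ldots,Q_k)$ in $A$, we have $\mathrm{Disc}_{z_i}(P)\notin \mathfrak{q}S$.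 Then the ideal $(P,Q_1,\ldots,Q_k)$ of $S$ is radical. -/

import Mathlib

/-- A local ring is Cohen–Macaulay if it is Noetherian and its maximal ideal contains a regular
sequence whose length is the Krull dimension of the ring. -/
def IsCohenMacaulayLocalRing (R : Type*) [CommRing R] [IsLocalRing R] : Prop :=
  IsNoetherianRing R ∧
    ∃ fs : List R, (∀ f ∈ fs, f ∈ IsLocalRing.maximalIdeal R) ∧
      RingTheory.Sequence.IsRegular R fs ∧
      ((fs.length : ℕ∞) : WithBot ℕ∞) = ringKrullDim R

/-- A ring is Cohen–Macaulay if it is Noetherian and its localization at every maximal ideal is a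
Cohen–Macaulay local ring. -/
def IsCohenMacaulayRing (R : Type*) [CommRing R] : Prop :=
  IsNoetherianRing R ∧
    ∀ (m : Ideal R) [m.IsMaximal], IsCohenMacaulayLocalRing (Localization.AtPrime m)

namespace MvPolynomial

open Classical in
/-- The polynomial `P`, viewed as a univariate polynomial in the variable `X i`. The new
indeterminate is `Polynomial.X`; the coefficients are polynomials in the variables `X j`, `j ≠ i`,
regarded as elements of the full polynomial ring. -/
noncomputable def asPolynomialIn {K σ : Type*} [CommRing K] (i : σ) (P : MvPolynomial σ K) :
    Polynomial (MvPolynomial σ K) :=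
  aeval (fun j => if j = i then Polynomial.X else Polynomial.C (X j)) P

/-- The discriminant of `P` with respect to the variable `X i`, that is, the resultant with
respect to `X i` of `P` and `∂P/∂(X i)`. -/
noncomputable def discIn {K σ : Type*} [CommRing K] (i : σ) (P : MvPolynomial σ K) :
    MvPolynomial σ K :=
  Polynomial.resultant (asPolynomialIn i P) (Polynomial.derivative (asPolynomialIn i P))

end MvPolynomial

/-! Write `S = A[z]` and `I = (Q_1, …, Q_k)`. Since `P` lies outside `(x)S`, it has a monomial in
the `z_i` alone; by homogeneity its full `A`-coefficient is a nonzero constant. Hence `P` is a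
non-zero-divisor modulo `LS` for every ideal `L` of `A` (McCoy's argument). Over the residue field
of a minimal prime `q` of `I`, a repeated factor of `P` involving `z_i` would divide `P` and
`∂P/∂z_i`, hence the discriminant, which is nonzero there and free of `z_i`. So `P` is square-free
generically on `V(I)`. If `f ^ n ∈ M = (P) + IS`, then `P` divides `f` over each such field, and
clearing denominators with prime avoidance gives `a ∈ A` outside all minimal primes with `a f ∈ M`.
Regularity of `P` modulo `(a) + I`, then of `a` modulo `IS`, removes `a`. -/

namespace MvPolynomial

/-! ### Regularity from a unit coefficient -/

/-- A multivariate polynomial with a unit coefficient is a non-zero-divisor. -/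
theorem eq_zero_of_mul_eq_zero_of_isUnit_coeff {σ R : Type*} [CommRing R]
    {P : MvPolynomial σ R} (hP : ∃ m, IsUnit (P.coeff m)) (g : MvPolynomial σ R)
    (h : P * g = 0) : g = 0 := by
  classical
  cases exists_wellFoundedGT σ
  let o : MonomialOrder σ := MonomialOrder.degLex
  induction hn : g.support.card using Nat.strong_induction_on generalizing g with
  | _ n ih =>
  by_contra hg
  -- Take the largest `a` whose coefficient does not kill `g`, and the leading exponent `b` of `g`.
  -- Only `P_a g_b` contributes to degree `a + b`, so it vanishes; then `P_a g` has smaller support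
  -- and is still killed by `P`.
  have key : ∀ a, C (P.coeff a) * g = 0 := by
    by_contra! hne
    have hfin : (P.support.filter fun a => C (P.coeff a) * g ≠ 0).Nonempty := by
      obtain ⟨a, ha⟩ := hne
      refine ⟨a, Finset.mem_filter.2 ⟨mem_support_iff.2 fun h0 => ha (by simp [h0]), ha⟩⟩
    obtain ⟨a, ha, hmax⟩ := Finset.exists_max_image _ o.toSyn hfin
    rw [Finset.mem_filter] at ha
    obtain ⟨b, hb, hbmax⟩ := Finset.exists_max_image _ o.toSyn (support_nonempty.2 hg)
    have hlead : P.coeff a * g.coeff b = 0 := by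
      have h1 : (P * g).coeff (a + b) = P.coeff a * g.coeff b := by
        rw [coeff_mul]
        refine Finset.sum_eq_single (a, b) ?_ (by simp)
        rintro ⟨c, e⟩ hce hne
        rw [Finset.HasAntidiagonal.mem_antidiagonal] at hce
        dsimp only at hce ⊢
        by_cases hc : C (P.coeff c) * g = 0
        · simpa using congrArg (coeff e) hc
        · have hca : o.toSyn c ≤ o.toSyn a := hmax c <| Finset.mem_filter.2
            ⟨mem_support_iff.2 fun h0 => hc (by simp [h0]), hc⟩
          by_contra hz
          have heb : o.toSyn e ≤ o.toSyn b :=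
            hbmax e (mem_support_iff.2 fun h0 => hz (by simp [h0]))
          have hs : o.toSyn c + o.toSyn e = o.toSyn a + o.toSyn b := by
            rw [← map_add, ← map_add, hce]
          have h2 : o.toSyn c = o.toSyn a := by
            by_contra hlt
            exact absurd hs (ne_of_lt (add_lt_add_of_lt_of_le (lt_of_le_of_ne hca hlt) heb))
          have h3 : c = a := o.toSyn.injective h2
          subst h3
          exact hne (by rw [add_left_cancel hce])
      rw [← h1, h, coeff_zero]
    refine ha.2 (ih _ ?_ (C (P.coeff a) * g) (by rw [mul_left_comm, h, mul_zero]) rfl)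
    rw [← hn]
    refine Finset.card_lt_card ((Finset.ssubset_iff_of_subset fun e he => ?_).2 ⟨b, hb, ?_⟩)
    · rw [mem_support_iff, coeff_C_mul] at he
      exact mem_support_iff.2 fun h0 => he (by rw [h0, mul_zero])
    · rw [mem_support_iff, coeff_C_mul, hlead]; simp
  obtain ⟨m, hm⟩ := hP
  exact hg (((hm.map (C : R →+* MvPolynomial σ R)).mul_right_eq_zero).1 (key m))

/-- A polynomial with a unit coefficient is a non-zero-divisor modulo extended ideals. -/
theorem mem_map_C_of_mul_mem_of_isUnit_coeff {σ R : Type*} [CommRing R] (L : Ideal R)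
    {P : MvPolynomial σ R} (hP : ∃ m, IsUnit (P.coeff m)) {g : MvPolynomial σ R}
    (h : P * g ∈ L.map (C : R →+* MvPolynomial σ R)) :
    g ∈ L.map (C : R →+* MvPolynomial σ R) := by
  have hker : ∀ f : MvPolynomial σ R, f ∈ L.map (C : R →+* MvPolynomial σ R) ↔
      map (Ideal.Quotient.mk L) f = 0 := by
    intro f
    rw [mem_map_C_iff, MvPolynomial.ext_iff]
    simp [coeff_map, Ideal.Quotient.eq_zero_iff_mem]
  rw [hker] at h ⊢
  rw [map_mul] at h
  obtain ⟨m, hm⟩ := hP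
  exact eq_zero_of_mul_eq_zero_of_isUnit_coeff
    ⟨m, by rw [coeff_map]; exact hm.map (Ideal.Quotient.mk L)⟩ _ h

/-! ### Square-freeness and residue fields -/

/-- A criterion for square-freeness: for each variable, `f` and its partial derivative
generate a nonzero element free of that variable. -/
theorem squarefree_of_exists_eliminant {σ F : Type*} [Field F] {f : MvPolynomial σ F}
    (hf : f ≠ 0) (H : ∀ i ∈ f.vars, ∃ D u v : MvPolynomial σ F,
      D ≠ 0 ∧ i ∉ D.vars ∧ u * f + v * pderiv i f = D) : Squarefree f := by
  classical
  have hmem : ∀ (i : σ) (p q : MvPolynomial σ F), p ∣ q → q ≠ 0 → i ∈ p.vars → i ∈ q.vars := by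
    rintro i p _ ⟨q, rfl⟩ h0 hi
    have hp := left_ne_zero_of_mul h0
    have hq := right_ne_zero_of_mul h0
    rw [mem_vars_iff_degreeOf_ne_zero] at hi ⊢
    rw [degreeOf_mul_eq hp hq]
    omega
  intro h hh
  have h0 : h ≠ 0 := by
    rintro rfl
    exact hf (by simpa using hh)
  obtain ⟨c, hc⟩ := hh
  rcases h.vars.eq_empty_or_nonempty with he | ⟨i, hi⟩
  · have hC := vars_eq_empty_iff_eq_C.1 he
    rw [hC] at h0 ⊢
    exact (isUnit_iff_ne_zero.2 fun ha => h0 (by rw [ha, C_0])).map C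
  · have hhf : h ∣ f := ⟨h * c, by rw [hc, mul_assoc]⟩
    obtain ⟨D, u, v, hD, hiD, e⟩ := H i (hmem i h f hhf hf hi)
    -- Since `h * h` divides `f`, the factor `h` divides both `f` and `pderiv i f`, hence `D`; but
    -- `h` involves `X i`.
    refine absurd (hmem i h D ?_ hD hi) hiD
    rw [← e]
    refine dvd_add (hhf.mul_left u) (Dvd.dvd.mul_left ?_ v)
    rw [hc, mul_assoc, Derivation.leibniz, Derivation.leibniz]
    simp only [smul_eq_mul]
    exact ⟨pderiv i (h * c) + c * pderiv i h, by simp only [Derivation.leibniz, smul_eq_mul]; ring⟩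

/-- Common denominators for polynomials over a residue field. -/
theorem exists_C_mul_eq_map_residueField {σ A : Type*} [CommRing A] (q : Ideal A) [q.IsPrime]
    (g : MvPolynomial σ q.ResidueField) : ∃ c ∉ q, ∃ g' : MvPolynomial σ A,
      C (algebraMap A q.ResidueField c) * g = map (algebraMap A q.ResidueField) g' := by
  induction g using MvPolynomial.induction_on with
  | C a =>
    obtain ⟨x, y, hy, rfl⟩ := IsFractionRing.div_surjective (A := A ⧸ q) a
    obtain ⟨x, rfl⟩ := Ideal.Quotient.mk_surjective x
    obtain ⟨y, rfl⟩ := Ideal.Quotient.mk_surjective y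
    have hyq : y ∉ q := fun h => nonZeroDivisors.ne_zero hy (Ideal.Quotient.eq_zero_iff_mem.2 h)
    refine ⟨y, hyq, C x, ?_⟩
    have hy0 : algebraMap A q.ResidueField y ≠ 0 := fun h0 => hyq (by
      rwa [Ideal.algebraMap_residueField_eq_zero] at h0)
    have e : ∀ t : A, algebraMap (A ⧸ q) q.ResidueField (Ideal.Quotient.mk q t) =
      algebraMap A q.ResidueField t := fun t => rfl
    rw [map_C, ← C_mul, e, e, mul_div_cancel₀ _ hy0]
  | add p r hp hr =>
    obtain ⟨c, hc, p', hp'⟩ := hp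
    obtain ⟨e, he, r', hr'⟩ := hr
    refine ⟨c * e, fun h => (Ideal.IsPrime.mem_or_mem ‹_› h).elim hc he,
      C e * p' + C c * r', ?_⟩
    simp only [map_mul, map_add, map_C, ← hp', ← hr']
    ring
  | mul_X p i hp =>
    obtain ⟨c, hc, p', hp'⟩ := hp
    exact ⟨c, hc, p' * X i, by rw [← mul_assoc, hp', map_mul, map_X]⟩

end MvPolynomial

/-! ### Minimal primes of a radical ideal -/

/-- An ideal not contained in any minimal prime of `I` contains an element avoiding all of them. -/
theorem Ideal.exists_mem_forall_notMem_minimalPrimes {A : Type*} [CommRing A]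
    [IsNoetherianRing A] (I J : Ideal A) (h : ∀ q ∈ I.minimalPrimes, ¬ J ≤ q) :
    ∃ a ∈ J, ∀ q ∈ I.minimalPrimes, a ∉ q := by
  by_contra! hc
  have hsub : (J : Set A) ⊆ ⋃ q ∈ I.minimalPrimes, (id q : Ideal A) := by
    intro a ha
    obtain ⟨q, hq, haq⟩ := hc a ha
    exact Set.mem_biUnion hq haq
  -- Prime avoidance allows two exceptional indices; `⊥` is an arbitrary filler, as every member is
  -- prime.
  obtain ⟨q, hq, hle⟩ := (Ideal.subset_union_prime_finite
    (I.finite_minimalPrimes_of_isNoetherianRing A) ⊥ ⊥ fun q hq _ _ => hq.1.1).1 hsub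
  exact h q hq hle

/-- A minimal prime of a radical ideal `I` in a Noetherian ring is carried into `I` by some
element outside of it. -/
theorem Ideal.exists_notMem_forall_mul_mem_of_mem_minimalPrimes {A : Type*} [CommRing A]
    [IsNoetherianRing A] {I q : Ideal A} (hI : I.IsRadical) (hq : q ∈ I.minimalPrimes) :
    ∃ u ∉ q, ∀ x ∈ q, u * x ∈ I := by
  classical
  have hqp : q.IsPrime := hq.1.1
  have hfin := I.finite_minimalPrimes_of_isNoetherianRing A
  -- The multiplier `u` is taken in all the other minimal primes but not in `q`.
  have hinf : ¬ (hfin.toFinset.erase q).inf id ≤ q := by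
    rw [hqp.inf_le']
    rintro ⟨p, hp, hle⟩
    rw [Finset.mem_erase, Set.Finite.mem_toFinset] at hp
    exact hp.1 (le_antisymm hle (hq.2 hp.2.1 hle))
  obtain ⟨u, hu, huq⟩ := SetLike.not_le_iff_exists.1 hinf
  refine ⟨u, huq, fun x hx => ?_⟩
  rw [← hI.radical, ← Ideal.sInf_minimalPrimes, Submodule.mem_sInf]
  intro p hp
  by_cases hpq : p = q
  · rw [hpq]
    exact q.mul_mem_left u hx
  · exact Ideal.mul_mem_right x p (Finset.inf_le (f := id)
      (Finset.mem_erase.2 ⟨hpq, hfin.mem_toFinset.2 hp⟩) hu)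

/-! ### From generic square-freeness to radicality -/

namespace MvPolynomial

/-- If `I` is radical, `P` has a unit coefficient and `P` is square-free over the residue field of
every minimal prime of `I`, then `P` and `I` generate a radical ideal. -/
theorem isRadical_span_singleton_sup_map_C {σ A : Type*} [CommRing A] [IsNoetherianRing A]
    {I : Ideal A} (hI : I.IsRadical) {P : MvPolynomial σ A} (hP : ∃ m, IsUnit (P.coeff m))
    (hsq : ∀ (q : Ideal A) [q.IsPrime], q ∈ I.minimalPrimes →
      Squarefree (map (algebraMap A q.ResidueField) P)) :
    (Ideal.span {P} ⊔ I.map (C : A →+* MvPolynomial σ A)).IsRadical := by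
  rintro f ⟨n, hf⟩
  set M := Ideal.span {P} ⊔ I.map (C : A →+* MvPolynomial σ A)
  -- The elements of `A` multiplying `f` into `M` form an ideal; it lies in no minimal prime `q`,
  -- because it contains `u * c` with `c` a denominator and `u` carrying `q` into `I`.
  obtain ⟨a, ha, haq⟩ := I.exists_mem_forall_notMem_minimalPrimes
      ((M.colon {f}).comap (C : A →+* MvPolynomial σ A)) <| by
    intro q hq hle
    have hqp : q.IsPrime := hq.1.1
    let φ := algebraMap A q.ResidueField
    have hker : ∀ x, φ x = 0 ↔ x ∈ q := fun x => Ideal.algebraMap_residueField_eq_zero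
    have hdvd : map φ P ∣ map φ f := by
      refine (hsq q hq).isRadical n _ ?_
      have hM : M.map (map φ : MvPolynomial σ A →+* _) ≤ Ideal.span {map φ P} := by
        rw [Ideal.map_sup, Ideal.map_span, Set.image_singleton]
        refine sup_le le_rfl ?_
        rw [Ideal.map_map, Ideal.map_le_iff_le_comap]
        intro x hx
        have : φ x = 0 := (hker x).2 (hq.1.2 hx)
        simp [this]
      have := hM (Ideal.mem_map_of_mem _ hf)
      rwa [map_pow, Ideal.mem_span_singleton] at this
    obtain ⟨g, hg⟩ := hdvd
    obtain ⟨c, hc, g', hg'⟩ := exists_C_mul_eq_map_residueField q g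
    obtain ⟨u, hu, huq⟩ := Ideal.exists_notMem_forall_mul_mem_of_mem_minimalPrimes hI hq
    refine (hqp.mem_or_mem (hle (x := u * c) ?_)).elim hu hc
    have hz : map φ (C c * f - P * g') = 0 := by
      rw [map_sub, map_mul, map_mul, map_C, hg, ← hg']
      ring
    have hmem : C u * (C c * f - P * g') ∈ I.map (C : A →+* MvPolynomial σ A) := by
      rw [mem_map_C_iff]
      intro m
      rw [coeff_C_mul]
      exact huq _ ((hker _).1 (by rw [← coeff_map, hz, coeff_zero]))
    rw [Ideal.mem_comap, Submodule.mem_colon_singleton, smul_eq_mul]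
    have e : C (u * c) * f = P * (C u * g') + C u * (C c * f - P * g') := by
      rw [C_mul]; ring
    rw [e]
    exact M.add_mem (M.mul_mem_right _ (Ideal.mem_sup_left (Ideal.mem_span_singleton_self P)))
      (Ideal.mem_sup_right hmem)
  rw [Ideal.mem_comap, Submodule.mem_colon_singleton, smul_eq_mul] at ha
  have hcancel : ∀ h : MvPolynomial σ A, C a * h ∈ I.map (C : A →+* MvPolynomial σ A) →
      h ∈ I.map (C : A →+* MvPolynomial σ A) := by
    intro h hh
    rw [mem_map_C_iff] at hh ⊢
    intro m
    have hm := hh m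
    rw [coeff_C_mul] at hm
    rw [← hI.radical, ← Ideal.sInf_minimalPrimes, Submodule.mem_sInf]
    intro q hq
    exact (hq.1.1.mem_or_mem (hq.1.2 hm)).resolve_left (haq q hq)
  obtain ⟨y, hy, z, hz, hyz⟩ := Submodule.mem_sup.1 ha
  obtain ⟨g, rfl⟩ := Ideal.mem_span_singleton.1 hy
  -- From `a f = P g + z`, the product `P g` vanishes modulo `(a) + I`, where `P` is regular.
  have hg : g ∈ (Ideal.span {a} ⊔ I).map (C : A →+* MvPolynomial σ A) := by
    refine mem_map_C_of_mul_mem_of_isUnit_coeff _ hP ?_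
    rw [eq_sub_of_add_eq hyz, Ideal.map_sup]
    exact Ideal.sub_mem _ (Ideal.mem_sup_left (Ideal.mul_mem_right _ _
      (Ideal.mem_map_of_mem _ (Ideal.mem_span_singleton_self a)))) (Ideal.mem_sup_right hz)
  rw [Ideal.map_sup, Ideal.map_span, Set.image_singleton] at hg
  obtain ⟨t, ht, w, hw, rfl⟩ := Submodule.mem_sup.1 hg
  obtain ⟨g', rfl⟩ := Ideal.mem_span_singleton.1 ht
  have hfin : f - P * g' ∈ I.map (C : A →+* MvPolynomial σ A) := by
    refine hcancel _ ?_
    have e : C a * (f - P * g') = P * w + z := by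
      rw [mul_sub, ← hyz]; ring
    rw [e]
    exact Ideal.add_mem _ (Ideal.mul_mem_left _ _ hw) hz
  rw [← sub_add_cancel f (P * g')]
  exact M.add_mem (Ideal.mem_sup_right hfin)
    (M.mul_mem_right _ (Ideal.mem_sup_left (Ideal.mem_span_singleton_self P)))

/-! ### Elimination by the discriminant -/

open Classical in
/-- The substitution of `0` for the variable `X i`. -/
noncomputable def substZero {R σ : Type*} [CommRing R] (i : σ) :
    MvPolynomial σ R →ₐ[R] MvPolynomial σ R :=
  bind₁ fun j => if j = i then 0 else X j

/-- Absence of a variable becomes an equation, which ring homomorphisms compatible with `substZero`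
preserve. -/
theorem notMem_vars_of_substZero_eq {R σ : Type*} [CommRing R] {i : σ} {f : MvPolynomial σ R}
    (h : substZero i f = f) : i ∉ f.vars := by
  classical
  rw [← h]
  intro hi
  obtain ⟨j, -, hj⟩ := Finset.mem_biUnion.1 (vars_bind₁ _ f hi)
  split_ifs at hj with hji
  · simp at hj
  · rcases subsingleton_or_nontrivial R with _ | _
    · simp [Subsingleton.elim (X j : MvPolynomial σ R) 0] at hj
    rw [vars_X, Finset.mem_singleton] at hj
    exact hji hj.symm

theorem substZero_eq_of_notMem_vars {R σ : Type*} [CommRing R] {i : σ} {f : MvPolynomial σ R}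
    (h : i ∉ f.vars) : substZero i f = f := by
  classical
  refine hom_congr_vars (f₁ := (substZero i).toRingHom) (f₂ := RingHom.id _) ?_ ?_ rfl
  · ext; simp [substZero]
  · intro j hj _
    have : j ≠ i := fun e => h (e ▸ hj)
    simp [substZero, this]

theorem map_substZero_asPolynomialIn {R σ : Type*} [CommRing R] (i : σ) (f : MvPolynomial σ R) :
    (asPolynomialIn i f).map (substZero i).toRingHom = asPolynomialIn i f := by
  classical
  have : ((Polynomial.mapRingHom (substZero i).toRingHom).comp
      (aeval fun j => if j = i then Polynomial.X else Polynomial.C (X j) :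
        MvPolynomial σ R →ₐ[R] Polynomial (MvPolynomial σ R)).toRingHom) =
      (aeval fun j => if j = i then Polynomial.X else Polynomial.C (X j) :
        MvPolynomial σ R →ₐ[R] Polynomial (MvPolynomial σ R)).toRingHom := by
    refine ringHom_ext (fun r => ?_) fun j => ?_
    · simp [Polynomial.algebraMap_apply, substZero, algebraMap_eq]
    · by_cases h : j = i <;> simp [h, substZero]
  exact RingHom.congr_fun this f

theorem eval_asPolynomialIn {R σ : Type*} [CommRing R] (i : σ) (f : MvPolynomial σ R) :
    (asPolynomialIn i f).eval (X i) = f := by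
  classical
  have : ((Polynomial.evalRingHom (X i)).comp
      (aeval fun j => if j = i then Polynomial.X else Polynomial.C (X j) :
        MvPolynomial σ R →ₐ[R] Polynomial (MvPolynomial σ R)).toRingHom) = RingHom.id _ := by
    refine ringHom_ext (fun r => ?_) fun j => ?_
    · simp [Polynomial.algebraMap_apply, algebraMap_eq]
    · by_cases h : j = i <;> simp [h]
  exact RingHom.congr_fun this f

theorem eval_derivative_asPolynomialIn {R σ : Type*} [CommRing R] (i : σ)
    (f : MvPolynomial σ R) :
    (Polynomial.derivative (asPolynomialIn i f)).eval (X i) = pderiv i f := by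
  classical
  induction f using MvPolynomial.induction_on with
  | C a => simp [asPolynomialIn, Polynomial.algebraMap_apply]
  | add p q hp hq =>
    rw [map_add, ← hp, ← hq]
    simp [asPolynomialIn]
  | mul_X p j hp =>
    have e : asPolynomialIn i (p * X j) = asPolynomialIn i p * asPolynomialIn i (X j) := by
      simp [asPolynomialIn]
    rw [e, Polynomial.derivative_mul, Polynomial.eval_add, Polynomial.eval_mul,
      Polynomial.eval_mul, hp, eval_asPolynomialIn, eval_asPolynomialIn, pderiv_mul]
    have hj : (Polynomial.derivative (asPolynomialIn i (X j : MvPolynomial σ R))).eval (X i) =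
        pderiv i (X j) := by
      by_cases h : j = i
      · simp [asPolynomialIn, h]
      · simp [asPolynomialIn, h, pderiv_X_of_ne h]
    rw [hj]

/-- The coefficients of `asPolynomialIn i f` are free of `X i`, and resultants with fixed formal
degrees commute with ring homomorphisms. -/
theorem substZero_discIn {R σ : Type*} [CommRing R] (i : σ) (f : MvPolynomial σ R) :
    substZero i (discIn i f) = discIn i f := by
  have h := map_substZero_asPolynomialIn i f
  have := Polynomial.resultant_map_map (asPolynomialIn i f)
    (Polynomial.derivative (asPolynomialIn i f)) (asPolynomialIn i f).natDegree
    (Polynomial.derivative (asPolynomialIn i f)).natDegree (substZero i).toRingHom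
  rw [← Polynomial.derivative_map, h] at this
  exact this.symm

theorem natDegree_asPolynomialIn_ne_zero {R σ : Type*} [CommRing R] {i : σ}
    {f : MvPolynomial σ R} (hi : i ∈ f.vars) : (asPolynomialIn i f).natDegree ≠ 0 := by
  intro h
  rw [Polynomial.natDegree_eq_zero] at h
  obtain ⟨c, hc⟩ := h
  have h1 := map_substZero_asPolynomialIn i f
  rw [← hc, Polynomial.map_C] at h1
  have h2 := eval_asPolynomialIn i f
  rw [← hc, Polynomial.eval_C] at h2
  subst h2
  exact notMem_vars_of_substZero_eq (Polynomial.C_injective h1) hi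

/-- The discriminant in `X i` is a combination of the polynomial and its derivative. -/
theorem exists_mul_add_mul_pderiv_eq_discIn {R σ : Type*} [CommRing R] {i : σ}
    {f : MvPolynomial σ R} (hi : i ∈ f.vars) :
    ∃ u v, u * f + v * pderiv i f = discIn i f := by
  -- A nonzero formal degree is essential: for two constants the resultant is `1`, whatever ideal
  -- they generate.
  obtain ⟨p, q, -, -, h⟩ := Polynomial.exists_mul_add_mul_eq_C_resultant (asPolynomialIn i f)
    (Polynomial.derivative (asPolynomialIn i f)) le_rfl le_rfl
    (Or.inl (natDegree_asPolynomialIn_ne_zero hi))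
  have := congrArg (Polynomial.eval (X i)) h
  rw [Polynomial.eval_add, Polynomial.eval_mul, Polynomial.eval_mul, Polynomial.eval_C,
    eval_asPolynomialIn, eval_derivative_asPolynomialIn] at this
  exact ⟨p.eval (X i), q.eval (X i), by rw [mul_comm _ f, mul_comm _ (pderiv i f)]; exact this⟩

/-! ### Separating the variables `z` and `x` -/

/-- Substituting zero for a left variable commutes with a change of the coefficients in the
right variables. -/
theorem map_sumAlgEquiv_substZero {K σ τ F : Type*} [CommRing K] [CommRing F]
    (φ : MvPolynomial τ K →+* F) (i : σ) (f : MvPolynomial (σ ⊕ τ) K) :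
    map φ (sumAlgEquiv K σ τ (substZero (Sum.inl i) f)) =
      substZero i (map φ (sumAlgEquiv K σ τ f)) := by
  classical
  have : ((map φ).comp (sumAlgEquiv K σ τ).toRingEquiv.toRingHom).comp
      (substZero (Sum.inl i)).toRingHom =
      (substZero i).toRingHom.comp ((map φ).comp (sumAlgEquiv K σ τ).toRingEquiv.toRingHom) := by
    refine ringHom_ext (fun r => ?_) ?_
    · simp [substZero]
    · rintro (j | j)
      · by_cases h : j = i <;> simp [h, substZero]
      · simp [substZero]
  exact RingHom.congr_fun this f

theorem sumAlgEquiv_monomial {K σ τ : Type*} [CommRing K] (m : σ →₀ ℕ) (n : τ →₀ ℕ) (a : K) :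
    sumAlgEquiv K σ τ (monomial (Finsupp.sumElim m n) a) = monomial m (monomial n a) := by
  have hs : Finsupp.sumFinsuppAddEquivProdFinsupp (Finsupp.sumElim m n) = (m, n) :=
    Finsupp.sumFinsuppAddEquivProdFinsupp.apply_symm_apply (m, n)
  simp [sumAlgEquiv, monomial, hs]

theorem coeff_coeff_sumAlgEquiv {K σ τ : Type*} [CommRing K] (f : MvPolynomial (σ ⊕ τ) K)
    (m : σ →₀ ℕ) (n : τ →₀ ℕ) :
    ((sumAlgEquiv K σ τ f).coeff m).coeff n = f.coeff (Finsupp.sumElim m n) := by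
  classical
  induction f using MvPolynomial.induction_on' with
  | add p q hp hq => rw [map_add, coeff_add, coeff_add, coeff_add, hp, hq]
  | monomial u a =>
    obtain ⟨⟨m', n'⟩, rfl⟩ := Finsupp.sumFinsuppEquivProdFinsupp.symm.surjective u
    have e : Finsupp.sumFinsuppEquivProdFinsupp.symm (m', n') = Finsupp.sumElim m' n' := rfl
    have hi : Finsupp.sumElim m' n' = Finsupp.sumElim m n ↔ (m', n') = (m, n) :=
      (Finsupp.sumFinsuppEquivProdFinsupp (α := σ) (β := τ)).symm.injective.eq_iff
        (a := (m', n')) (b := (m, n))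
    rw [Prod.mk.injEq] at hi
    rw [e, sumAlgEquiv_monomial]
    rw [coeff_monomial, coeff_monomial]
    split_ifs with h1 h2 h2 <;> simp_all [coeff_monomial]

/-- A weighted homogeneous polynomial outside the ideal of the right variables has a unit
coefficient with respect to the left variables. -/
theorem exists_isUnit_coeff_sumAlgEquiv {K σ τ : Type*} [Field K] {d : σ → ℕ} {e : τ → ℕ}
    (he : ∀ j, e j ≠ 0) {P : MvPolynomial (σ ⊕ τ) K} {n : ℕ}
    (hP : IsWeightedHomogeneous (Sum.elim d e) P n)
    (hPx : P ∉ Ideal.span (Set.range fun j : τ => (X (Sum.inr j) : MvPolynomial (σ ⊕ τ) K))) :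
    ∃ m, IsUnit ((sumAlgEquiv K σ τ P).coeff m) := by
  classical
  have hr : (Set.range fun j : τ => (X (Sum.inr j) : MvPolynomial (σ ⊕ τ) K)) =
      X '' Set.range Sum.inr := by
    rw [← Set.range_comp]; rfl
  rw [hr, mem_ideal_span_X_image] at hPx
  push Not at hPx
  obtain ⟨u, hu, hur⟩ := hPx
  have hw : ∀ (m : σ →₀ ℕ) (b : τ →₀ ℕ), Finsupp.weight (Sum.elim d e) (Finsupp.sumElim m b) =
      Finsupp.weight d m + Finsupp.weight e b := by
    intro m b
    have : Finsupp.sumElim m b = m.mapDomain Sum.inl + b.mapDomain Sum.inr := by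
      ext (j | j)
      · simp [Finsupp.mapDomain_apply Sum.inl_injective, Finsupp.mapDomain_of_notMem_range]
      · simp [Finsupp.mapDomain_apply Sum.inr_injective, Finsupp.mapDomain_of_notMem_range]
    rw [this, map_add, Finsupp.weight_apply, Finsupp.weight_apply, Finsupp.weight_apply,
      Finsupp.weight_apply, Finsupp.sum_mapDomain_index_inj Sum.inl_injective,
      Finsupp.sum_mapDomain_index_inj Sum.inr_injective]
    rfl
  let m : σ →₀ ℕ := u.comapDomain Sum.inl Sum.inl_injective.injOn
  have hum : u = Finsupp.sumElim m 0 := by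
    ext (j | j)
    · simp [m]
    · simpa using hur (Sum.inr j) ⟨j, rfl⟩
  have hu0 : P.coeff (Finsupp.sumElim m 0) ≠ 0 := hum ▸ mem_support_iff.1 hu
  refine ⟨m, ?_⟩
  -- Any other monomial of `P` with the same `z`-part `m` would have an `x`-part of weight zero,
  -- impossible for positive weights.
  have hC : (sumAlgEquiv K σ τ P).coeff m = C (P.coeff (Finsupp.sumElim m 0)) := by
    ext b
    rw [coeff_coeff_sumAlgEquiv, coeff_C]
    split_ifs with hb
    · rw [hb]
    · by_contra hne
      have h1 := hP hne
      have h2 := hP hu0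
      rw [hw] at h1 h2
      rw [map_zero] at h2
      have h3 : Finsupp.weight e b = 0 := by omega
      have : Finsupp.NonTorsionWeight ℕ e := Finsupp.nonTorsionWeight_of ℕ e he
      exact hb ((Finsupp.weight_eq_zero_iff_eq_zero e).1 h3).symm
  rw [hC]
  exact (isUnit_iff_ne_zero.2 hu0).map C

/-- Square-freeness over the residue field of a prime modulo which the discriminants do not
vanish. -/
theorem squarefree_map_residueField {K σ τ : Type*} [Field K] {P : MvPolynomial (σ ⊕ τ) K}
    (hP : ∃ m, IsUnit ((sumAlgEquiv K σ τ P).coeff m)) (q : Ideal (MvPolynomial τ K)) [q.IsPrime]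
    (hdisc : ∀ i : σ, Sum.inl i ∈ P.vars →
      discIn (Sum.inl i) P ∉ q.map (rename (R := K) (Sum.inr : τ → σ ⊕ τ))) :
    Squarefree (map (algebraMap (MvPolynomial τ K) q.ResidueField) (sumAlgEquiv K σ τ P)) := by
  set φ := algebraMap (MvPolynomial τ K) q.ResidueField
  refine squarefree_of_exists_eliminant ?_ ?_
  · intro h0
    obtain ⟨m, hm⟩ := hP
    have := congrArg (coeff m) h0
    rw [coeff_map, coeff_zero] at this
    exact (hm.map φ).ne_zero this
  · intro i hi
    have hiP : Sum.inl i ∈ P.vars := by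
      by_contra hn
      refine notMem_vars_of_substZero_eq ?_ hi
      rw [← map_sumAlgEquiv_substZero, substZero_eq_of_notMem_vars hn]
    obtain ⟨u, v, huv⟩ := exists_mul_add_mul_pderiv_eq_discIn hiP
    refine ⟨map φ (sumAlgEquiv K σ τ (discIn (Sum.inl i) P)), map φ (sumAlgEquiv K σ τ u),
      map φ (sumAlgEquiv K σ τ v), ?_, ?_, ?_⟩
    -- If the discriminant died over the residue field, all its `A`-coefficients would lie in `q`.
    · intro h0
      refine hdisc i hiP ?_
      have hmem : sumAlgEquiv K σ τ (discIn (Sum.inl i) P) ∈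
          q.map (C : MvPolynomial τ K →+* MvPolynomial σ (MvPolynomial τ K)) := by
        rw [mem_map_C_iff]
        intro m
        rw [← Ideal.algebraMap_residueField_eq_zero, ← coeff_map, h0, coeff_zero]
      have := Ideal.mem_map_of_mem (sumAlgEquiv K σ τ).symm hmem
      rw [AlgEquiv.symm_apply_apply] at this
      refine Ideal.map_le_iff_le_comap.2 ?_ this
      rw [Ideal.map_le_iff_le_comap]
      intro x hx
      have hx' : (sumAlgEquiv K σ τ).symm (C x) = rename Sum.inr x := by
        rw [AlgEquiv.symm_apply_eq]
        exact (AlgHom.congr_fun (sumAlgEquiv_comp_rename_inr K σ τ) x).symm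
      rw [Ideal.mem_comap, Ideal.mem_comap, hx']
      exact Ideal.mem_map_of_mem _ hx
    · refine notMem_vars_of_substZero_eq ?_
      rw [← map_sumAlgEquiv_substZero, substZero_discIn]
    · rw [pderiv_map, pderiv_sumAlgEquiv, ← map_mul, ← map_mul, ← map_mul, ← map_mul,
        ← map_add, ← map_add, huv]

end MvPolynomial

theorem mainTheorem4 {K : Type*} [Field K] [IsAlgClosed K] [CharZero K] {r s k : ℕ}
    -- the (positive) degrees of the variables `z_i` and `x_j`
    (d : Fin r → ℕ) (e : Fin s → ℕ) (hd : ∀ i, 1 ≤ d i) (he : ∀ j, 1 ≤ e j)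
    -- `P ∈ K[z, x]` and `Q_1, …, Q_k ∈ K[x]` are homogeneous of positive degree
    (P : MvPolynomial (Fin r ⊕ Fin s) K) (Q : Fin k → MvPolynomial (Fin s) K)
    (hP : ∃ m : ℕ, 0 < m ∧ MvPolynomial.IsWeightedHomogeneous (Sum.elim d e) P m)
    (hQ : ∀ l, ∃ m : ℕ, 0 < m ∧ MvPolynomial.IsWeightedHomogeneous e (Q l) m)
    (hCM : IsCohenMacaulayRing (MvPolynomial (Fin s) K ⧸ Ideal.span (Set.range Q)))
    (hrad : (Ideal.span (Set.range Q)).IsRadical)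
    (hsq : Squarefree P)
    (hPx : P ∉ Ideal.span (Set.range fun j : Fin s =>
      (MvPolynomial.X (Sum.inr j) : MvPolynomial (Fin r ⊕ Fin s) K)))
    (hdisc : ∀ i : Fin r, Sum.inl i ∈ P.vars →
      ∀ q ∈ (Ideal.span (Set.range Q)).minimalPrimes,
        MvPolynomial.discIn (Sum.inl i) P ∉
          Ideal.map (MvPolynomial.rename (R := K) (Sum.inr : Fin s → Fin r ⊕ Fin s)) q) :
    (Ideal.span (insert P (Set.range fun l : Fin k =>
      MvPolynomial.rename (Sum.inr : Fin s → Fin r ⊕ Fin s) (Q l)))).IsRadical := by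
  have hunit : ∃ m, IsUnit ((MvPolynomial.sumAlgEquiv K (Fin r) (Fin s) P).coeff m) := by
    obtain ⟨n, -, hn⟩ := hP
    exact MvPolynomial.exists_isUnit_coeff_sumAlgEquiv
      (fun j => Nat.one_le_iff_ne_zero.1 (he j)) hn hPx
  have hmain := MvPolynomial.isRadical_span_singleton_sup_map_C hrad hunit fun q _ hq =>
    MvPolynomial.squarefree_map_residueField hunit q fun i hi => hdisc i hi q hq
  -- The isomorphism `K[z, x] ≃ K[x][z]` turns the `Q l` into constants.
  have hmap : (Ideal.span (insert P (Set.range fun l : Fin k =>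
      MvPolynomial.rename (Sum.inr : Fin s → Fin r ⊕ Fin s) (Q l)))).map
        (MvPolynomial.sumAlgEquiv K (Fin r) (Fin s)) =
      Ideal.span {MvPolynomial.sumAlgEquiv K (Fin r) (Fin s) P} ⊔
        (Ideal.span (Set.range Q)).map MvPolynomial.C := by
    rw [Ideal.map_span, Ideal.map_span, Set.image_insert_eq, Ideal.span_insert,
      ← Set.range_comp, ← Set.range_comp]
    congr 3
    ext1 l
    exact AlgHom.congr_fun (MvPolynomial.sumAlgEquiv_comp_rename_inr K (Fin r) (Fin s)) (Q l)
  rw [← hmap] at hmain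
  have hcomap := hmain.comap (MvPolynomial.sumAlgEquiv K (Fin r) (Fin s))
  rwa [Ideal.comap_map_of_bijective _ (MvPolynomial.sumAlgEquiv K (Fin r) (Fin s)).bijective]
    at hcomap
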